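/- Let $p\in\mathbb N$. Let $\mathcal F_c(\mathbb R^p)$ be the class of functions $A:\mathbb R^p\to[0,1]$ whose $\alpha$-levels $A_\alpha=\{x: A(x)\ge\alpha\}$ ($0<\alpha\le 1$) and $A_0=\overline{\{x:A(x)>0\}}$ are all non-empty, compact and convex ("fuzzy sets"). For $A,B\in\mathcal F_c(\mathbb R^p)$, $\gamma\in\mathbb R$ and a matrix $M\in\mathbb R^{p\times p}$, set $(A+B)(t)=\sup_{x+y=t}\min\{A(x),B(y)\}$, $(\gamma\cdot A)(t)=\sup_{\gamma x=t}A(x)$ and $(M\cdot A)(t)=\sup_{Mx=t}A(x)$ (with $\sup\emptyset=0$). The support function of $A$ is $s_A(u,\alpha)=\sup_{v\in A_\alpha}\langle u,v\rangle$ for $u\in\mathbb S^{p-1}=\{u\in\mathbb R^p:\|u\|=1\}$, $\alpha\in[0,1]$. For $r\in[1,\infty)$ put $$d_r(A,B)=\Big(\int_0^1 d_{\mathcal H}(A_\alpha,B_\alpha)^r\,d\alpha\Big)^{1/r},\qquad d_\infty(A,B)=\sup_{\alpha\in[0,1]}d_{\mathcal H}(A_\alpha,B_\alpha),$$ $$\rho_r(A,B)=\Big(\int_{\mathbb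 S^{p-1}}\int_0^1|s_A(u,\alpha)-s_B(u,\alpha)|^r\,d\alpha\,d\mathcal V_p(u)\Big)^{1/r},$$ where $d_{\mathcal H}$ is the Hausdorff metric and $\mathcal V_p$ is the normalized rotation-invariant measure on $\mathbb S^{p-1}$. Let $(\Omega,\mathcal A,\mathbb P)$ be a probability space. A fuzzy random variable is a map $\mathcal X:\Omega\to\mathcal F_c(\mathbb R^p)$ such that $\{\omega:\mathcal X(\omega)_\alpha\cap K\ne\emptyset\}\in\mathcal A$ for every $\alpha\in[0,1]$ and every non-empty compact convex $K\subseteq\mathbb R^p$. For $A_1,\dots,A_{p+1}\in\mathcal F_c(\mathbb R^p)$, the pseudosimplex $S_F[A_1,\dots,A_{p+1}]$ is the set of all $A\in\mathcal F_c(\mathbb R^p)$ with $$\min_i s_{A_i}(u,\alpha)\le s_A(u,\alpha)\le\max_i s_{A_i}(u,\alpha)\quad\text{for all }u\in\mathbb S^{p-1},\ \alpha\in[0,1].$$ The naive simplicial depth is $D_{nS}(A;\mathcal X)=\mathbb P(A\in S_F[\mathcal X_1,\dots,\mathcal X_{p+1}])$, where $\mathcal X_1,\dots,\mathcal X_{p+1}$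 are independent observations of $\mathcal X$ (independent copies of $\mathcal X$, realized as the coordinates on the product space $\Omega^{p+1}$). **Theorem.** For every fuzzy random variable $\mathcal X:\Omega\to\mathcal F_c(\mathbb R^p)$ and every $\mathcal J\subseteq\mathcal F_c(\mathbb R^p)$ (for instance $\mathcal J=\mathcal F_c(\mathbb R^p)$): 1. (P1) $D_{nS}(M\cdot C+B;\,M\cdot\mathcal X+B)=D_{nS}(C;\mathcal X)$ for every non-singular $M\in\mathbb R^{p\times p}$ and all $B,C\in\mathcal J$. 2. (P4a) If $A\in\mathcal J$ satisfies $D_{nS}(A;\mathcal X)=\sup_{C\in\mathcal J}D_{nS}(C;\mathcal X)$, then $\lim_{\lambda\to\infty}D_{nS}(A+\lambda\cdot B;\mathcal X)=0$ for every $B\in\mathcal J$ with $B\neq \mathrm I_{\{0\}}$, where $\mathrm I_{\{0\}}$ is the indicator function of $\{0\}$. 3. (P4b) Let $d$ be any $d_r$ with $r\in[1,\infty]$ or any $\rho_r$ with $r\in[1,\infty)$. If $A\in\mathcal J$ satisfies $D_{nS}(A;\mathcal X)=\sup_{C\in\mathcal J}D_{nS}(C;\mathcal X)$, and $(A_n)_n$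 is a sequence in $\mathcal F_c(\mathbb R^p)$ with $\lim_n d(A_n,A)=\infty$, then $\lim_nD_{nS}(A_n;\mathcal X)=0$. -/

import Mathlib

namespace FuzzyDepth

open scoped unitInterval ENNReal

/-- Sup over fibres: `zadeh g F t = sup {F y : g y = t}` (the supremum in `[0,1]`, so `sup ∅ = 0`).
This is Zadeh's extension principle. -/
noncomputable def zadeh {Y E : Type*} (g : Y → E) (F : Y → I) (t : E) : I :=
  ⨆ (y : Y) (_ : g y = t), F y

/-- The `α`-level of a function with values in `[0,1]`: the set `{x | α ≤ A x}` for `α ∈ (0,1]`,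
the closed support for `α = 0`. -/
def levelSet {E : Type*} [TopologicalSpace E] (A : E → I) (α : I) : Set E :=
  {x | (α = 0 ∧ x ∈ closure {y | 0 < A y}) ∨ (α ≠ 0 ∧ α ≤ A x)}

theorem levelSet_zero {E : Type*} [TopologicalSpace E] (A : E → I) :
    levelSet A 0 = closure {y | 0 < A y} := by
  ext x; simp [levelSet]

theorem levelSet_of_ne {E : Type*} [TopologicalSpace E] (A : E → I) {α : I} (h : α ≠ 0) :
    levelSet A α = {x | α ≤ A x} := by
  ext x; simp [levelSet, h]

theorem setOf_pos_zadeh {Y E : Type*} (g : Y → E) (F : Y → I) :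
    {t | 0 < zadeh g F t} = g '' {y | 0 < F y} := by
  ext t
  simp only [zadeh, Set.mem_ofPred_eq, lt_iSup_iff, Set.mem_image]
  constructor
  · rintro ⟨y, h, hy⟩; exact ⟨y, hy, h⟩
  · rintro ⟨y, hy, h⟩; exact ⟨y, h, hy⟩

theorem levelSet_zadeh {Y E : Type*} [TopologicalSpace Y] [T2Space Y] [TopologicalSpace E]
    [T2Space E] {g : Y → E} (hg : Continuous g) {F : Y → I}
    (hF : ∀ α, IsCompact (levelSet F α)) (α : I) :
    levelSet (zadeh g F) α = g '' levelSet F α := by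
  by_cases hα : α = 0
  · subst hα
    rw [levelSet_zero, levelSet_zero, setOf_pos_zadeh]
    have h0 := hF 0
    rw [levelSet_zero] at h0
    exact (image_closure_of_isCompact h0 hg.continuousOn).symm
  · rw [levelSet_of_ne _ hα, levelSet_of_ne _ hα]
    have husc : UpperSemicontinuous F := by
      rw [upperSemicontinuous_iff_isClosed_preimage]
      intro β
      by_cases hβ : β = 0
      · subst hβ
        have : F ⁻¹' Set.Ici (0 : I) = Set.univ := by
          ext y; simp
        rw [this]; exact isClosed_univ
      · have h := hF β
        rw [levelSet_of_ne _ hβ] at h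
        exact h.isClosed
    ext t
    simp only [Set.mem_ofPred_eq, Set.mem_image]
    constructor
    · intro ht
      have hpos : 0 < zadeh g F t := lt_of_lt_of_le (lt_of_le_of_ne bot_le (Ne.symm hα)) ht
      obtain ⟨y₀, hy₀, hgy₀⟩ : t ∈ g '' {y | 0 < F y} := by
        rw [← setOf_pos_zadeh]; exact hpos
      have hK : IsCompact (levelSet F (F y₀) ∩ g ⁻¹' {t}) :=
        (hF _).inter_right (isClosed_singleton.preimage hg)
      rw [levelSet_of_ne _ (ne_of_gt hy₀)] at hK
      obtain ⟨y, ⟨hy1, hy2⟩, hmax⟩ :=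
        UpperSemicontinuousOn.exists_isMaxOn (α := Y)
          (s := {x | F y₀ ≤ F x} ∩ g ⁻¹' {t}) ⟨y₀, le_refl (F y₀), hgy₀⟩ hK
          (husc.upperSemicontinuousOn _)
      refine ⟨y, ht.trans ?_, hy2⟩
      refine iSup₂_le fun z hz => ?_
      by_cases h : F y₀ ≤ F z
      · exact hmax ⟨h, hz⟩
      · exact (le_of_lt (not_le.mp h)).trans hy1
    · rintro ⟨y, hy, rfl⟩
      exact hy.trans (le_iSup₂ (f := fun (z : Y) (_ : g z = g y) => F z) y rfl)

/-- `F_c(ℝ^p)`: functions `ℝ^p → [0,1]` all of whose `α`-levels, `α ∈ [0,1]`, are non-empty,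
compact and convex. -/
@[ext]
structure FuzzySet (p : ℕ) where
  toFun : EuclideanSpace ℝ (Fin p) → I
  nonempty_level : ∀ α, (levelSet toFun α).Nonempty
  isCompact_level : ∀ α, IsCompact (levelSet toFun α)
  convex_level : ∀ α, Convex ℝ (levelSet toFun α)

namespace FuzzySet

variable {p : ℕ}

/-- The `α`-level `A_α`. -/
def level (A : FuzzySet p) (α : I) : Set (EuclideanSpace ℝ (Fin p)) :=
  levelSet A.toFun α

open Classical in
/-- The indicator function `I_K` of a non-empty compact convex set. -/
noncomputable def indicator (K : Set (EuclideanSpace ℝ (Fin p))) (hne : K.Nonempty)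
    (hK : IsCompact K) (hc : Convex ℝ K) : FuzzySet p :=
  have h (α : I) : levelSet (fun x => if x ∈ K then (1 : I) else 0) α = K := by
    by_cases hα : α = 0
    · subst hα
      rw [levelSet_zero]
      have : {y | 0 < (if y ∈ K then (1 : I) else 0)} = K := by
        ext y; by_cases hy : y ∈ K <;> simp [hy]
      rw [this, hK.isClosed.closure_eq]
    · rw [levelSet_of_ne _ hα]
      ext y
      by_cases hy : y ∈ K
      · simp [hy, unitInterval.le_one']
      · simpa [hy] using hα
  { toFun := fun x => if x ∈ K then 1 else 0
    nonempty_level := fun α => by rw [h]; exact hne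
    isCompact_level := fun α => by rw [h]; exact hK
    convex_level := fun α => by rw [h]; exact hc }

/-- The fuzzy set `I_{\{0\}}`. -/
noncomputable def zeroPoint (p : ℕ) : FuzzySet p :=
  indicator {0} (Set.singleton_nonempty 0) isCompact_singleton (convex_singleton 0)

/-- The image `f(A)` under a linear map, by Zadeh's extension principle. -/
noncomputable def map (f : EuclideanSpace ℝ (Fin p) →L[ℝ] EuclideanSpace ℝ (Fin p))
    (A : FuzzySet p) : FuzzySet p where
  toFun := zadeh f A.toFun
  nonempty_level α := by
    rw [levelSet_zadeh f.continuous A.isCompact_level]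
    exact (A.nonempty_level α).image _
  isCompact_level α := by
    rw [levelSet_zadeh f.continuous A.isCompact_level]
    exact (A.isCompact_level α).image f.continuous
  convex_level α := by
    rw [levelSet_zadeh f.continuous A.isCompact_level]
    exact (A.convex_level α).linear_image f.toLinearMap

theorem level_map (f : EuclideanSpace ℝ (Fin p) →L[ℝ] EuclideanSpace ℝ (Fin p))
    (A : FuzzySet p) (α : I) : (map f A).level α = f '' A.level α :=
  levelSet_zadeh f.continuous A.isCompact_level α

theorem levelSet_min (A B : FuzzySet p) (α : I) :
    levelSet (fun q : EuclideanSpace ℝ (Fin p) × EuclideanSpace ℝ (Fin p) =>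
      min (A.toFun q.1) (B.toFun q.2)) α = A.level α ×ˢ B.level α := by
  unfold level
  by_cases hα : α = 0
  · subst hα
    rw [levelSet_zero, levelSet_zero, levelSet_zero, ← closure_prod_eq]
    congr 1
    ext q; simp [Set.mem_prod]
  · rw [levelSet_of_ne _ hα, levelSet_of_ne _ hα, levelSet_of_ne _ hα]
    ext q; simp [Set.mem_prod]

theorem isCompact_levelSet_min (A B : FuzzySet p) (α : I) :
    IsCompact (levelSet (fun q : EuclideanSpace ℝ (Fin p) × EuclideanSpace ℝ (Fin p) =>
      min (A.toFun q.1) (B.toFun q.2)) α) := by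
  rw [levelSet_min]
  exact (A.isCompact_level α).prod (B.isCompact_level α)

theorem levelSet_add (A B : FuzzySet p) (α : I) :
    levelSet (zadeh (fun q : EuclideanSpace ℝ (Fin p) × EuclideanSpace ℝ (Fin p) => q.1 + q.2)
      fun q => min (A.toFun q.1) (B.toFun q.2)) α =
    (fun q : EuclideanSpace ℝ (Fin p) × EuclideanSpace ℝ (Fin p) => q.1 + q.2) ''
      (A.level α ×ˢ B.level α) := by
  rw [levelSet_zadeh continuous_add (isCompact_levelSet_min A B), levelSet_min]

/-- `(A + B)(t) = sup {min (A x) (B y) : x + y = t}`. -/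
noncomputable instance : Add (FuzzySet p) where
  add A B :=
    { toFun := zadeh (fun q : EuclideanSpace ℝ (Fin p) × EuclideanSpace ℝ (Fin p) => q.1 + q.2)
        fun q => min (A.toFun q.1) (B.toFun q.2)
      nonempty_level := fun α => by
        rw [levelSet_add]
        exact ((A.nonempty_level α).prod (B.nonempty_level α)).image _
      isCompact_level := fun α => by
        rw [levelSet_add]
        exact ((A.isCompact_level α).prod (B.isCompact_level α)).image continuous_add
      convex_level := fun α => by
        rw [levelSet_add]
        have h := (A.convex_level α).add (B.convex_level α)
        rwa [← Set.image2_add, ← Set.image_prod] at h }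

/-- `(γ · A)(t) = sup {A x : t = γ x}`. -/
noncomputable instance : SMul ℝ (FuzzySet p) where
  smul γ A := map (γ • ContinuousLinearMap.id ℝ (EuclideanSpace ℝ (Fin p))) A

/-- `(M · A)(t) = sup {A x : t = M x}`. -/
noncomputable instance : SMul (Matrix (Fin p) (Fin p) ℝ) (FuzzySet p) where
  smul M A := map (Matrix.toEuclideanCLM (n := Fin p) (𝕜 := ℝ) M) A

end FuzzySet

/-- The support function `s_K(u) = sup_{v ∈ K} ⟪u, v⟫`. -/
noncomputable def supportFun {p : ℕ} (K : Set (EuclideanSpace ℝ (Fin p)))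
    (u : EuclideanSpace ℝ (Fin p)) : ℝ :=
  sSup ((fun v => inner ℝ u v) '' K)

/-- The support function `s_A(u, α)` of a fuzzy set. -/
noncomputable def FuzzySet.supportFun {p : ℕ} (A : FuzzySet p) (u : EuclideanSpace ℝ (Fin p))
    (α : I) : ℝ :=
  FuzzyDepth.supportFun (A.level α) u

/-- `K_c(ℝ^p)`. -/
def compactConvex (p : ℕ) : Set (Set (EuclideanSpace ℝ (Fin p))) :=
  {K | K.Nonempty ∧ IsCompact K ∧ Convex ℝ K}

/-- The pseudosimplex `S_c[K_1, …, K_{p+1}]` in `K_c(ℝ^p)`. -/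
def pseudosimplexSets {p : ℕ} (K : Fin (p + 1) → Set (EuclideanSpace ℝ (Fin p))) :
    Set (Set (EuclideanSpace ℝ (Fin p))) :=
  {L | L ∈ compactConvex p ∧ ∀ u ∈ Metric.sphere (0 : EuclideanSpace ℝ (Fin p)) 1,
    supportFun L u ∈ Set.Icc (⨅ i, supportFun (K i) u) (⨆ i, supportFun (K i) u)}

/-- The pseudosimplex `S_F[A_1, …, A_{p+1}]` in `F_c(ℝ^p)`. -/
def pseudosimplex {p : ℕ} (A : Fin (p + 1) → FuzzySet p) : Set (FuzzySet p) :=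
  {C | ∀ α : I, C.level α ∈ pseudosimplexSets fun i => (A i).level α}

/-- A random compact set: hitting events of non-empty compact convex sets are measurable. -/
def IsRandomCompactSet {Ω : Type*} [MeasurableSpace Ω] {p : ℕ}
    (Γ : Ω → Set (EuclideanSpace ℝ (Fin p))) : Prop :=
  (∀ ω, Γ ω ∈ compactConvex p) ∧
    ∀ K ∈ compactConvex p, MeasurableSet {ω | (Γ ω ∩ K).Nonempty}

/-- A fuzzy random variable: all its `α`-levels are random compact sets. -/
def IsFuzzyRandomVariable {Ω : Type*} [MeasurableSpace Ω] {p : ℕ} (X : Ω → FuzzySet p) : Prop :=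
  ∀ α : I, IsRandomCompactSet fun ω => (X ω).level α

/-- The naive simplicial depth `D_nS(A; X) = P(A ∈ S_F[X_1, …, X_{p+1}])`. The `p + 1` independent
observations of `X` are the maps `ω ↦ X (ω i)` on the product space `Ω^{p+1}` with the measure
`P ⊗ ⋯ ⊗ P`. -/
noncomputable def naiveSimplicialDepth {Ω : Type*} [MeasurableSpace Ω]
    (P : MeasureTheory.Measure Ω) {p : ℕ} (A : FuzzySet p) (X : Ω → FuzzySet p) : ℝ :=
  (MeasureTheory.Measure.pi fun _ : Fin (p + 1) => P).real
    {ω | A ∈ pseudosimplex fun i => X (ω i)}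

/-- The metrics `d_r`, `r ∈ [1, ∞]`. -/
noncomputable def dMetric {p : ℕ} (r : ℝ≥0∞) (A B : FuzzySet p) : ℝ :=
  if r = ∞ then ⨆ α : I, Metric.hausdorffDist (A.level α) (B.level α)
  else (∫ α : I, Metric.hausdorffDist (A.level α) (B.level α) ^ r.toReal) ^ (1 / r.toReal)

/-- The uniform (normalized rotation invariant) probability measure on the unit sphere. -/
noncomputable def sphereMeasure (p : ℕ) :
    MeasureTheory.Measure (Metric.sphere (0 : EuclideanSpace ℝ (Fin p)) 1) :=
  ((MeasureTheory.volume : MeasureTheory.Measure (EuclideanSpace ℝ (Fin p))).toSphere Set.univ)⁻¹ •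
    (MeasureTheory.volume : MeasureTheory.Measure (EuclideanSpace ℝ (Fin p))).toSphere

/-- The metrics `ρ_r`, `r ∈ [1, ∞)`. -/
noncomputable def rhoMetric {p : ℕ} (r : ℝ) (A B : FuzzySet p) : ℝ :=
  (∫ u : Metric.sphere (0 : EuclideanSpace ℝ (Fin p)) 1,
    ∫ α : I, |A.supportFun u α - B.supportFun u α| ^ r ∂MeasureTheory.volume
      ∂(sphereMeasure p)) ^ (1 / r)

/-- Affine invariance, for a depth `D`, a class `J` of fuzzy sets and a fuzzy random variable `X`. -/
def AffineInvariant {Ω : Type*} {p : ℕ} (D : FuzzySet p → (Ω → FuzzySet p) → ℝ)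
    (J : Set (FuzzySet p)) (X : Ω → FuzzySet p) : Prop :=
  ∀ M : Matrix (Fin p) (Fin p) ℝ, M.det ≠ 0 → ∀ B ∈ J, ∀ C ∈ J,
    D (M • C + B) (fun ω => M • X ω + B) = D C X

/-- `A ∈ J` has maximal depth in `J`. -/
def IsDeepest {p : ℕ} (D : FuzzySet p → ℝ) (J : Set (FuzzySet p)) (A : FuzzySet p) : Prop :=
  A ∈ J ∧ ∀ C ∈ J, D C ≤ D A

/-- The depth tends to `0` along `A + l · B`, `l → ∞`, for a deepest `A` in `J` and every `B ∈ J`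
other than `I_{\{0\}}`. -/
def VanishesAlongRays {p : ℕ} (D : FuzzySet p → ℝ) (J : Set (FuzzySet p)) : Prop :=
  ∀ A, IsDeepest D J A → ∀ B ∈ J, B ≠ FuzzySet.zeroPoint p →
    Filter.Tendsto (fun l : ℝ => D (A + l • B)) Filter.atTop (nhds 0)

/-- The depth tends to `0` along every sequence whose `d`-distance to a deepest `A` in `J` tends to
infinity. -/
def VanishesAtInfinity {p : ℕ} (D : FuzzySet p → ℝ) (J : Set (FuzzySet p))
    (d : FuzzySet p → FuzzySet p → ℝ) : Prop :=
  ∀ A, IsDeepest D J A → ∀ S : ℕ → FuzzySet p,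
    Filter.Tendsto (fun n => d (S n) A) Filter.atTop Filter.atTop →
      Filter.Tendsto (fun n => D (S n)) Filter.atTop (nhds 0)

end FuzzyDepth

namespace FuzzyDepth

open MeasureTheory Filter Topology Set

open scoped unitInterval ENNReal

/-! ### Calculus of support functions of fuzzy sets. -/

section SupportFunction

variable {p : ℕ}

/-! Affine invariance is an identity of events. Support functions turn Minkowski sums into sums and
a linear image under `f` into precomposition with the adjoint of `f`. By positive homogeneity the
pseudosimplex inequalities may be tested at every vector `u`, so translation by `B` cancels and an
invertible `M` merely permutes the test vectors (`map_add_mem_pseudosimplex_iff`).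

Both vanishing statements rest on one estimate. If `C` lies in the pseudosimplex of the `X_i` and `x
∈ C_0`, testing in the direction `x` itself gives some `X_i` with a point of norm at least `‖x‖` in
its 0-level. A union bound then controls the depth by `p + 1` times the probability that one random
0-level reaches far out (`naiveSimplicialDepth_le`). That probability tends to 0 because each
0-level is bounded. Hence the depth vanishes along any family whose 0-levels contain points of norm
tending to infinity (`tendsto_naiveSimplicialDepth_zero`). Rays supply such points from a nonzero
point of `B_0`; for the metrics, the distance is at most the sum of the radii of the two 0-levels.
-/

theorem isGreatest_supportFun {K : Set (EuclideanSpace ℝ (Fin p))} (hne : K.Nonempty)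
    (hK : IsCompact K) (u : EuclideanSpace ℝ (Fin p)) :
    IsGreatest ((fun v => inner ℝ u v) '' K) (supportFun K u) :=
  (hK.image (by fun_prop)).isGreatest_sSup (hne.image _)

theorem FuzzySet.isGreatest_supportFun (A : FuzzySet p) (u : EuclideanSpace ℝ (Fin p)) (α : I) :
    IsGreatest ((fun v => inner ℝ u v) '' A.level α) (A.supportFun u α) :=
  FuzzyDepth.isGreatest_supportFun (A.nonempty_level α) (A.isCompact_level α) u

theorem FuzzySet.inner_le_supportFun (A : FuzzySet p) (u : EuclideanSpace ℝ (Fin p)) {α : I}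
    {v : EuclideanSpace ℝ (Fin p)} (hv : v ∈ A.level α) : inner ℝ u v ≤ A.supportFun u α :=
  (A.isGreatest_supportFun u α).2 ⟨v, hv, rfl⟩

theorem FuzzySet.exists_inner_eq_supportFun (A : FuzzySet p) (u : EuclideanSpace ℝ (Fin p))
    (α : I) : ∃ v ∈ A.level α, inner ℝ u v = A.supportFun u α :=
  (A.isGreatest_supportFun u α).1

theorem FuzzySet.supportFun_smul (A : FuzzySet p) {c : ℝ} (hc : 0 ≤ c)
    (u : EuclideanSpace ℝ (Fin p)) (α : I) :
    A.supportFun (c • u) α = c * A.supportFun u α := by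
  refine (A.isGreatest_supportFun (c • u) α).unique ⟨?_, ?_⟩
  · obtain ⟨v, hv, h⟩ := A.exists_inner_eq_supportFun u α
    exact ⟨v, hv, by simp only [real_inner_smul_left, h]⟩
  · rintro _ ⟨v, hv, rfl⟩
    simp only [real_inner_smul_left]
    exact mul_le_mul_of_nonneg_left (A.inner_le_supportFun u hv) hc

theorem FuzzySet.level_add (A B : FuzzySet p) (α : I) :
    (A + B).level α =
      (fun q : EuclideanSpace ℝ (Fin p) × EuclideanSpace ℝ (Fin p) => q.1 + q.2) ''
        (A.level α ×ˢ B.level α) :=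
  levelSet_add A B α

theorem FuzzySet.supportFun_add (A B : FuzzySet p) (u : EuclideanSpace ℝ (Fin p)) (α : I) :
    (A + B).supportFun u α = A.supportFun u α + B.supportFun u α := by
  refine ((A + B).isGreatest_supportFun u α).unique ⟨?_, ?_⟩
  · obtain ⟨v, hv, h⟩ := A.exists_inner_eq_supportFun u α
    obtain ⟨w, hw, h'⟩ := B.exists_inner_eq_supportFun u α
    rw [FuzzySet.level_add]
    exact ⟨v + w, ⟨(v, w), ⟨hv, hw⟩, rfl⟩, by simp only [inner_add_right, h, h']⟩
  · rw [FuzzySet.level_add]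
    rintro _ ⟨_, ⟨⟨v, w⟩, ⟨hv, hw⟩, rfl⟩, rfl⟩
    simp only [inner_add_right]
    exact add_le_add (A.inner_le_supportFun u hv) (B.inner_le_supportFun u hw)

theorem FuzzySet.supportFun_map
    (f : EuclideanSpace ℝ (Fin p) →L[ℝ] EuclideanSpace ℝ (Fin p)) (A : FuzzySet p)
    (u : EuclideanSpace ℝ (Fin p)) (α : I) :
    (FuzzySet.map f A).supportFun u α = A.supportFun (ContinuousLinearMap.adjoint f u) α := by
  unfold FuzzySet.supportFun FuzzyDepth.supportFun
  rw [FuzzySet.level_map, image_image]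
  simp only [ContinuousLinearMap.adjoint_inner_left]

theorem FuzzySet.level_subset_level_zero (A : FuzzySet p) (α : I) :
    A.level α ⊆ A.level 0 := by
  by_cases hα : α = 0
  · rw [hα]
  · unfold FuzzySet.level
    rw [levelSet_zero, levelSet_of_ne _ hα]
    exact fun x hx => subset_closure (lt_of_lt_of_le (lt_of_le_of_ne bot_le (Ne.symm hα)) hx)

end SupportFunction

/-! ### Pseudosimplices and affine invariance. -/

section Pseudosimplex

variable {p : ℕ}

theorem mem_Icc_ciInf_ciSup_iff {ι : Type*} [Finite ι] [Nonempty ι] (f : ι → ℝ) (x : ℝ) :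
    x ∈ Icc (⨅ i, f i) (⨆ i, f i) ↔ (∃ i, f i ≤ x) ∧ ∃ i, x ≤ f i := by
  constructor
  · rintro ⟨h₁, h₂⟩
    obtain ⟨i, hi⟩ := exists_eq_ciInf_of_finite (f := f)
    obtain ⟨j, hj⟩ := exists_eq_ciSup_of_finite (f := f)
    exact ⟨⟨i, hi.trans_le h₁⟩, j, h₂.trans_eq hj.symm⟩
  · rintro ⟨⟨i, hi⟩, j, hj⟩
    exact ⟨(ciInf_le (finite_range f).bddBelow i).trans hi,
      hj.trans (le_ciSup (finite_range f).bddAbove j)⟩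

/-- Extrema over finitely many indices are attained, and positive homogeneity frees `u` from the
sphere; at `u = 0` all support functions vanish. Unrestricted `u` lets one substitute an adjoint
image or a point of `C`. -/
theorem mem_pseudosimplex_iff (A : Fin (p + 1) → FuzzySet p) (C : FuzzySet p) :
    C ∈ pseudosimplex A ↔ ∀ (α : I) (u : EuclideanSpace ℝ (Fin p)),
      (∃ i, (A i).supportFun u α ≤ C.supportFun u α) ∧
        ∃ i, C.supportFun u α ≤ (A i).supportFun u α := by
  constructor
  · intro h α u
    rcases eq_or_ne u 0 with rfl | hu
    · have h0 (B : FuzzySet p) : B.supportFun 0 α = 0 := by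
        simpa using B.supportFun_smul le_rfl 0 α
      simp [h0]
    · have hu' : 0 < ‖u‖ := norm_pos_iff.2 hu
      have hs (B : FuzzySet p) :
          B.supportFun u α = ‖u‖ * B.supportFun (‖u‖⁻¹ • u) α := by
        rw [← B.supportFun_smul hu'.le, smul_inv_smul₀ hu'.ne']
      have := (h α).2 (‖u‖⁻¹ • u) (by simp [norm_smul, hu'.ne'])
      rw [mem_Icc_ciInf_ciSup_iff] at this
      simp only [hs, mul_le_mul_iff_right₀ hu']
      exact this
  · intro h α
    refine ⟨⟨C.nonempty_level α, C.isCompact_level α, C.convex_level α⟩, fun u _ => ?_⟩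
    rw [mem_Icc_ciInf_ciSup_iff]
    exact h α u

theorem map_add_mem_pseudosimplex_iff
    {f : EuclideanSpace ℝ (Fin p) →L[ℝ] EuclideanSpace ℝ (Fin p)}
    (hf : Function.Surjective (ContinuousLinearMap.adjoint f))
    (A : Fin (p + 1) → FuzzySet p) (B C : FuzzySet p) :
    (FuzzySet.map f C + B ∈ pseudosimplex fun i => FuzzySet.map f (A i) + B) ↔
      C ∈ pseudosimplex A := by
  simp only [mem_pseudosimplex_iff, FuzzySet.supportFun_add, FuzzySet.supportFun_map,
    add_le_add_iff_right]
  exact forall_congr' fun α => (hf.forall (p := fun u =>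
    (∃ i, (A i).supportFun u α ≤ C.supportFun u α) ∧
      ∃ i, C.supportFun u α ≤ (A i).supportFun u α)).symm

theorem surjective_adjoint_toEuclideanCLM {M : Matrix (Fin p) (Fin p) ℝ} (hM : M.det ≠ 0) :
    Function.Surjective
      (ContinuousLinearMap.adjoint (Matrix.toEuclideanCLM (n := Fin p) (𝕜 := ℝ) M)) := by
  -- `star` is the adjoint, so the adjoint of `M⁻¹` is a right inverse of the adjoint of `M`.
  have h : star (Matrix.toEuclideanCLM (n := Fin p) (𝕜 := ℝ) M) *
      star (Matrix.toEuclideanCLM (n := Fin p) (𝕜 := ℝ) M⁻¹) = 1 := by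
    rw [← star_mul, ← map_mul, Matrix.nonsing_inv_mul _ (isUnit_iff_ne_zero.2 hM), map_one,
      star_one]
  intro u
  exact ⟨star (Matrix.toEuclideanCLM (n := Fin p) (𝕜 := ℝ) M⁻¹) u, DFunLike.congr_fun h u⟩

theorem affineInvariant_naiveSimplicialDepth {Ω : Type*} [MeasurableSpace Ω] (P : Measure Ω)
    (J : Set (FuzzySet p)) (X : Ω → FuzzySet p) :
    AffineInvariant (naiveSimplicialDepth P) J X := by
  intro M hM B _ C _
  unfold naiveSimplicialDepth
  congr 1
  ext ω
  exact map_add_mem_pseudosimplex_iff (surjective_adjoint_toEuclideanCLM hM)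
    (fun i => X (ω i)) B C

end Pseudosimplex

/-! ### Tail bound for the depth. -/

section Tightness

variable {Ω : Type*} [MeasurableSpace Ω] {p : ℕ}

/-- Exhausting `H` by closed balls reduces to compact convex test sets, the only ones for which
measurability is assumed. -/
theorem IsRandomCompactSet.measurableSet_inter_nonempty
    {Γ : Ω → Set (EuclideanSpace ℝ (Fin p))} (hΓ : IsRandomCompactSet Γ)
    {H : Set (EuclideanSpace ℝ (Fin p))} (hH : IsClosed H) (hc : Convex ℝ H) :
    MeasurableSet {ω | (Γ ω ∩ H).Nonempty} := by
  have h : {ω | (Γ ω ∩ H).Nonempty} =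
      ⋃ m : ℕ, {ω | (Γ ω ∩ (Metric.closedBall 0 (m : ℝ) ∩ H)).Nonempty} := by
    ext ω
    simp only [mem_ofPred_eq, mem_iUnion]
    constructor
    · rintro ⟨v, hv, hvH⟩
      obtain ⟨m, hm⟩ := exists_nat_ge ‖v‖
      exact ⟨m, v, hv, by simpa using hm, hvH⟩
    · rintro ⟨m, v, hv, -, hvH⟩
      exact ⟨v, hv, hvH⟩
  rw [h]
  refine MeasurableSet.iUnion fun m => ?_
  rcases (Metric.closedBall (0 : EuclideanSpace ℝ (Fin p)) (m : ℝ) ∩ H).eq_empty_or_nonempty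
    with he | hne
  · simp [he]
  · exact hΓ.2 _ ⟨hne, (isCompact_closedBall _ _).inter_right hH,
      (convex_closedBall _ _).inter hc⟩

/-- The event that a random set leaves the open cube of half side length `c`. -/
def escapeEvent (Γ : Ω → Set (EuclideanSpace ℝ (Fin p))) (c : ℝ) : Set Ω :=
  {ω | ∃ v ∈ Γ ω, ∃ j, c ≤ |v j|}

/-- The complement of an open cube is a finite union of closed half-spaces, which are convex; the
complement of a ball has no such finite description in general. This is why cubes are used, at the
price of a factor `√p`. -/
theorem IsRandomCompactSet.measurableSet_escapeEvent
    {Γ : Ω → Set (EuclideanSpace ℝ (Fin p))} (hΓ : IsRandomCompactSet Γ) (c : ℝ) :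
    MeasurableSet (escapeEvent Γ c) := by
  have h : escapeEvent Γ c = ⋃ j : Fin p,
      ({ω | (Γ ω ∩ {v | c ≤ v j}).Nonempty} ∪ {ω | (Γ ω ∩ {v | v j ≤ -c}).Nonempty}) := by
    ext ω
    simp only [escapeEvent, mem_ofPred_eq, mem_iUnion, mem_union, Set.Nonempty, mem_inter_iff]
    constructor
    · rintro ⟨v, hv, j, hj⟩
      rcases le_abs.1 hj with h | h
      · exact ⟨j, Or.inl ⟨v, hv, h⟩⟩
      · exact ⟨j, Or.inr ⟨v, hv, by linarith⟩⟩
    · rintro ⟨j, ⟨v, hv, h⟩ | ⟨v, hv, h⟩⟩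
      · exact ⟨v, hv, j, le_abs.2 (Or.inl h)⟩
      · exact ⟨v, hv, j, le_abs.2 (Or.inr (by linarith))⟩
  have hl (j : Fin p) : IsLinearMap ℝ fun v : EuclideanSpace ℝ (Fin p) => v j :=
    ⟨fun _ _ => rfl, fun _ _ => rfl⟩
  rw [h]
  refine MeasurableSet.iUnion fun j => MeasurableSet.union ?_ ?_
  · exact hΓ.measurableSet_inter_nonempty (isClosed_le continuous_const (by fun_prop))
      (convex_halfSpace_ge (hl j) c)
  · exact hΓ.measurableSet_inter_nonempty (isClosed_le (by fun_prop) continuous_const)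
      (convex_halfSpace_le (hl j) (-c))

/-- Continuity from above: the events decrease, and none of the bounded sets `Γ ω` escapes every
cube. -/
theorem IsRandomCompactSet.tendsto_measure_escapeEvent (P : Measure Ω) [IsFiniteMeasure P]
    {Γ : Ω → Set (EuclideanSpace ℝ (Fin p))} (hΓ : IsRandomCompactSet Γ) :
    Tendsto (fun n : ℕ => P (escapeEvent Γ n)) atTop (𝓝 0) := by
  have hempty : ⋂ n : ℕ, escapeEvent Γ (n : ℝ) = ∅ := by
    rw [eq_empty_iff_forall_notMem]
    intro ω hω
    obtain ⟨R, hR⟩ := (hΓ.1 ω).2.1.isBounded.exists_norm_le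
    obtain ⟨n, hn⟩ := exists_nat_gt R
    obtain ⟨v, hv, j, hj⟩ := mem_iInter.1 hω n
    have := (PiLp.norm_apply_le v j).trans (hR v hv)
    rw [Real.norm_eq_abs] at this
    linarith
  have h := tendsto_measure_iInter_atTop (μ := P) (s := fun n : ℕ => escapeEvent Γ (n : ℝ))
    (fun n => (hΓ.measurableSet_escapeEvent n).nullMeasurableSet)
    (fun m n hmn ω ⟨v, hv, j, hj⟩ => ⟨v, hv, j, (Nat.cast_le.2 hmn).trans hj⟩)
    ⟨0, measure_ne_top _ _⟩
  rwa [hempty, measure_empty] at h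

theorem EuclideanSpace.norm_le_sqrt_mul {v : EuclideanSpace ℝ (Fin p)} {c : ℝ} (hc : 0 ≤ c)
    (h : ∀ j, |v j| ≤ c) : ‖v‖ ≤ √p * c := by
  rw [EuclideanSpace.norm_eq, Real.sqrt_le_left (by positivity), mul_pow,
    Real.sq_sqrt (Nat.cast_nonneg p)]
  calc ∑ j, ‖v j‖ ^ 2 ≤ ∑ _j : Fin p, c ^ 2 :=
        Finset.sum_le_sum fun j _ => pow_le_pow_left₀ (norm_nonneg _) (h j) 2
    _ = p * c ^ 2 := by simp

/-- With `u = x` and `v` maximizing `⟪x, ·⟫` on the level of a suitable `A i`: `‖x‖² ≤ s_C(x) ≤ ⟪x,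
v⟫ ≤ ‖x‖ ‖v‖`. -/
theorem exists_norm_le_of_mem_pseudosimplex {A : Fin (p + 1) → FuzzySet p} {C : FuzzySet p}
    (h : C ∈ pseudosimplex A) {α : I} {x : EuclideanSpace ℝ (Fin p)} (hx : x ∈ C.level α) :
    ∃ i, ∃ v ∈ (A i).level α, ‖x‖ ≤ ‖v‖ := by
  obtain ⟨-, i, hi⟩ := (mem_pseudosimplex_iff A C).1 h α x
  obtain ⟨v, hv, hvi⟩ := (A i).exists_inner_eq_supportFun x α
  refine ⟨i, v, hv, ?_⟩
  rcases (norm_nonneg x).eq_or_lt with h0 | h0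
  · exact h0 ▸ norm_nonneg v
  · have h1 := C.inner_le_supportFun x hx
    rw [real_inner_self_eq_norm_mul_norm] at h1
    have h2 := real_inner_le_norm x v
    exact le_of_mul_le_mul_left (by linarith) h0

theorem naiveSimplicialDepth_le (P : Measure Ω) [IsProbabilityMeasure P] {X : Ω → FuzzySet p}
    (hX : IsFuzzyRandomVariable X) {C : FuzzySet p} {x : EuclideanSpace ℝ (Fin p)}
    (hx : x ∈ C.level 0) {c : ℝ} (hc : 0 ≤ c) (hxc : √p * c < ‖x‖) :
    naiveSimplicialDepth P C X ≤
      (p + 1 : ℕ) * P.real (escapeEvent (fun ω => (X ω).level 0) c) := by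
  have hsub : {ω : Fin (p + 1) → Ω | C ∈ pseudosimplex fun i => X (ω i)} ⊆
      ⋃ i, Function.eval i ⁻¹' escapeEvent (fun ω => (X ω).level 0) c := by
    intro ω hω
    obtain ⟨i, v, hv, hxv⟩ := exists_norm_le_of_mem_pseudosimplex hω hx
    refine mem_iUnion.2 ⟨i, v, hv, ?_⟩
    by_contra! hj
    exact (hxc.trans_le hxv).not_ge (EuclideanSpace.norm_le_sqrt_mul hc fun j => (hj j).le)
  -- Monotonicity and subadditivity hold for arbitrary sets, so measurability of the pseudosimplex
  -- event is not needed.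
  refine (measureReal_mono hsub).trans ((measureReal_iUnion_fintype_le _).trans_eq ?_)
  have hi (i : Fin (p + 1)) : (Measure.pi fun _ : Fin (p + 1) => P).real
      (Function.eval i ⁻¹' escapeEvent (fun ω => (X ω).level 0) c) =
      P.real (escapeEvent (fun ω => (X ω).level 0) c) := by
    rw [measureReal_def, measureReal_def, (measurePreserving_eval _ i).measure_preimage
      ((hX 0).measurableSet_escapeEvent c).nullMeasurableSet]
  simp only [hi, Finset.sum_const, Finset.card_univ, Fintype.card_fin, nsmul_eq_mul]

theorem tendsto_naiveSimplicialDepth_zero (P : Measure Ω) [IsProbabilityMeasure P]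
    {X : Ω → FuzzySet p} (hX : IsFuzzyRandomVariable X) {ι : Type*} {l : Filter ι}
    {S : ι → FuzzySet p} {x : ι → EuclideanSpace ℝ (Fin p)} (hx : ∀ i, x i ∈ (S i).level 0)
    (hlim : Tendsto (fun i => ‖x i‖) l atTop) :
    Tendsto (fun i => naiveSimplicialDepth P (S i) X) l (𝓝 0) := by
  have htend : Tendsto (fun n : ℕ =>
      (p + 1 : ℕ) * P.real (escapeEvent (fun ω => (X ω).level 0) n)) atTop (𝓝 0) := by
    have h := (ENNReal.tendsto_toReal ENNReal.zero_ne_top).comp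
      ((hX 0).tendsto_measure_escapeEvent P)
    simpa [measureReal_def] using h.const_mul ((p + 1 : ℕ) : ℝ)
  refine tendsto_order.2 ⟨fun a ha => Eventually.of_forall fun i =>
    ha.trans_le measureReal_nonneg, fun a ha => ?_⟩
  obtain ⟨n, hn⟩ := (htend.eventually_lt_const ha).exists
  filter_upwards [hlim.eventually_gt_atTop (√p * n)] with i hi
  exact (naiveSimplicialDepth_le P hX (hx i) n.cast_nonneg hi).trans_lt hn

end Tightness

/-! ### Vanishing along rays. -/

section Rays

variable {Ω : Type*} [MeasurableSpace Ω] {p : ℕ}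

/-- Comparing at the level `α = A x` gives `A x ≤ B x`; the value 0 is separated because the 0-level
is a closure and does not record values. -/
theorem FuzzySet.ext_level {A B : FuzzySet p} (h : ∀ α, A.level α = B.level α) : A = B := by
  have key (A B : FuzzySet p) (h : ∀ α, A.level α = B.level α) (x) :
      A.toFun x ≤ B.toFun x := by
    by_cases h0 : A.toFun x = 0
    · rw [h0]; exact bot_le
    · have hx : x ∈ B.level (A.toFun x) := by
        rw [← h]
        exact Or.inr ⟨h0, le_rfl⟩
      unfold FuzzySet.level at hx
      rw [levelSet_of_ne _ h0] at hx
      exact hx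
  exact FuzzySet.ext (funext fun x => (key A B h x).antisymm (key B A (fun α => (h α).symm) x))

theorem FuzzySet.eq_zeroPoint_of_forall_mem {B : FuzzySet p} (h : ∀ v ∈ B.level 0, v = 0) :
    B = FuzzySet.zeroPoint p := by
  have hz (A : FuzzySet p) (hA : ∀ v ∈ A.level 0, v = 0) (α : I) : A.level α = {0} :=
    (Set.Nonempty.subset_singleton_iff (A.nonempty_level α)).1
      fun v hv => hA v (A.level_subset_level_zero α hv)
  refine FuzzySet.ext_level fun α => ?_
  rw [hz B h, hz]
  intro v hv
  unfold FuzzySet.level at hv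
  rw [levelSet_zero] at hv
  have : {y | 0 < (FuzzySet.zeroPoint p).toFun y} ⊆ {0} := by
    intro y hy
    by_contra hne
    simp only [mem_singleton_iff] at hne
    simp [FuzzySet.zeroPoint, FuzzySet.indicator, hne] at hy
  exact closure_minimal this isClosed_singleton hv

theorem FuzzySet.add_smul_mem_level (A B : FuzzySet p) (l : ℝ) {α : I}
    {a b : EuclideanSpace ℝ (Fin p)} (ha : a ∈ A.level α) (hb : b ∈ B.level α) :
    a + l • b ∈ (A + l • B).level α := by
  rw [FuzzySet.level_add]
  refine ⟨(a, l • b), ⟨ha, ?_⟩, rfl⟩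
  change l • b ∈ (FuzzySet.map _ B).level α
  rw [FuzzySet.level_map]
  exact ⟨b, hb, rfl⟩

theorem vanishesAlongRays_naiveSimplicialDepth (P : Measure Ω) [IsProbabilityMeasure P]
    {X : Ω → FuzzySet p} (hX : IsFuzzyRandomVariable X) (J : Set (FuzzySet p)) :
    VanishesAlongRays (fun A => naiveSimplicialDepth P A X) J := by
  intro A _ B _ hB
  obtain ⟨b, hb, hb0⟩ : ∃ b ∈ B.level 0, b ≠ 0 := by
    by_contra! h
    exact hB (FuzzySet.eq_zeroPoint_of_forall_mem h)
  obtain ⟨a, ha⟩ := A.nonempty_level 0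
  refine tendsto_naiveSimplicialDepth_zero P hX
    (fun l => A.add_smul_mem_level B l ha hb) ?_
  -- Lower bound for `‖a + l • b‖` by the reverse triangle inequality.
  have h1 : Tendsto (fun l : ℝ => l * ‖b‖ - ‖a‖) atTop atTop :=
    tendsto_atTop_add_const_right _ _ (tendsto_id.atTop_mul_const (norm_pos_iff.2 hb0))
  refine tendsto_atTop_mono (fun l => ?_) h1
  have h2 := norm_sub_norm_le (l • b) (-a)
  rw [norm_neg, sub_neg_eq_add, add_comm (l • b), norm_smul] at h2
  have h3 : l * ‖b‖ ≤ ‖l‖ * ‖b‖ :=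
    mul_le_mul_of_nonneg_right (Real.le_norm_self l) (norm_nonneg b)
  linarith

end Rays

/-! ### Vanishing at infinity for the metrics. -/

section Metrics

variable {p : ℕ}

theorem FuzzySet.exists_norm_max (A : FuzzySet p) :
    ∃ x ∈ A.level 0, ∀ α, ∀ v ∈ A.level α, ‖v‖ ≤ ‖x‖ := by
  obtain ⟨x, hx, hmax⟩ := (A.isCompact_level 0).exists_isMaxOn (A.nonempty_level 0)
    continuous_norm.continuousOn
  exact ⟨x, hx, fun α v hv => hmax (A.level_subset_level_zero α hv)⟩

variable {A B : FuzzySet p} {a b : ℝ}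

theorem hausdorffDist_level_le {α : I} (hA : ∀ v ∈ A.level α, ‖v‖ ≤ a)
    (hB : ∀ v ∈ B.level α, ‖v‖ ≤ b) :
    Metric.hausdorffDist (A.level α) (B.level α) ≤ a + b := by
  obtain ⟨x, hx⟩ := A.nonempty_level α
  obtain ⟨y, hy⟩ := B.nonempty_level α
  have ha := (norm_nonneg x).trans (hA x hx)
  have hb := (norm_nonneg y).trans (hB y hy)
  refine Metric.hausdorffDist_le_of_mem_dist (by positivity) (fun v hv => ⟨y, hy, ?_⟩)
    (fun v hv => ⟨x, hx, ?_⟩)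
  · exact (dist_le_norm_add_norm v y).trans (add_le_add (hA v hv) (hB y hy))
  · rw [dist_comm]
    exact (dist_le_norm_add_norm x v).trans (add_le_add (hA x hx) (hB v hv))

theorem FuzzySet.abs_supportFun_le {α : I} (hA : ∀ v ∈ A.level α, ‖v‖ ≤ a)
    {u : EuclideanSpace ℝ (Fin p)} (hu : ‖u‖ = 1) : |A.supportFun u α| ≤ a := by
  obtain ⟨v, hv, h⟩ := A.exists_inner_eq_supportFun u α
  rw [← h]
  refine (abs_real_inner_le_norm u v).trans ?_
  rw [hu, one_mul]
  exact hA v hv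

theorem rpow_one_div_le {x c r : ℝ} (hx : 0 ≤ x) (hc : 0 ≤ c) (hr : 0 < r) (h : x ≤ c ^ r) :
    x ^ (1 / r) ≤ c := by
  rw [one_div]
  exact (Real.rpow_inv_le_iff_of_pos hx hc hr).2 h

theorem dMetric_le {r : ℝ≥0∞} (hr : 1 ≤ r) (ha : 0 ≤ a) (hb : 0 ≤ b)
    (hA : ∀ α, ∀ v ∈ A.level α, ‖v‖ ≤ a) (hB : ∀ α, ∀ v ∈ B.level α, ‖v‖ ≤ b) :
    dMetric r A B ≤ a + b := by
  unfold dMetric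
  split_ifs with h
  · exact ciSup_le fun α => hausdorffDist_level_le (hA α) (hB α)
  · have hr' : 0 < r.toReal := ENNReal.toReal_pos (zero_lt_one.trans_le hr).ne' h
    refine rpow_one_div_le (integral_nonneg fun α => Real.rpow_nonneg
      Metric.hausdorffDist_nonneg _) (by positivity) hr' ?_
    -- No integrability is required: a non-integrable function has integral 0, which also satisfies
    -- the bound.
    have := norm_integral_le_of_norm_le_const (μ := (volume : Measure I))
      (f := fun α => Metric.hausdorffDist (A.level α) (B.level α) ^ r.toReal)
      (C := (a + b) ^ r.toReal) (Eventually.of_forall fun α => by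
        rw [Real.norm_of_nonneg (Real.rpow_nonneg Metric.hausdorffDist_nonneg _)]
        exact Real.rpow_le_rpow Metric.hausdorffDist_nonneg
          (hausdorffDist_level_le (hA α) (hB α)) hr'.le)
    rw [probReal_univ, mul_one] at this
    exact (Real.le_norm_self _).trans this

/-- Only an inequality, which covers `p = 0`, where the sphere is empty and the total mass is 0. -/
theorem sphereMeasure_univ_le (p : ℕ) : sphereMeasure p univ ≤ 1 :=
  ENNReal.inv_mul_le_one _

theorem rhoMetric_le {r : ℝ} (hr : 1 ≤ r) (ha : 0 ≤ a) (hb : 0 ≤ b)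
    (hA : ∀ α, ∀ v ∈ A.level α, ‖v‖ ≤ a) (hB : ∀ α, ∀ v ∈ B.level α, ‖v‖ ≤ b) :
    rhoMetric r A B ≤ a + b := by
  have hr' : 0 < r := zero_lt_one.trans_le hr
  have hab : 0 ≤ (a + b) ^ r := by positivity
  have hinner (u : Metric.sphere (0 : EuclideanSpace ℝ (Fin p)) 1) :
      ‖∫ α : I, |A.supportFun u α - B.supportFun u α| ^ r‖ ≤ (a + b) ^ r := by
    have := norm_integral_le_of_norm_le_const (μ := (volume : Measure I))
      (f := fun α => |A.supportFun u α - B.supportFun u α| ^ r)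
      (C := (a + b) ^ r) (Eventually.of_forall fun α => by
        rw [Real.norm_of_nonneg (by positivity)]
        refine Real.rpow_le_rpow (abs_nonneg _) ((abs_sub _ _).trans (add_le_add ?_ ?_)) hr'.le
        · exact FuzzySet.abs_supportFun_le (hA α) (norm_eq_of_mem_sphere u)
        · exact FuzzySet.abs_supportFun_le (hB α) (norm_eq_of_mem_sphere u))
    rwa [probReal_univ, mul_one] at this
  have : IsFiniteMeasure (sphereMeasure p) :=
    ⟨(sphereMeasure_univ_le p).trans_lt ENNReal.one_lt_top⟩
  refine rpow_one_div_le (integral_nonneg fun u => integral_nonneg fun α => by positivity)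
    (by positivity) hr' ?_
  exact (Real.le_norm_self _).trans ((norm_integral_le_of_norm_le_const
    (Eventually.of_forall hinner)).trans
      (mul_le_of_le_one_right hab
        (ENNReal.toReal_le_of_le_ofReal zero_le_one (by simpa using sphereMeasure_univ_le p))))

/-- The bound `hd` is all that is used of `d`: for `x n` and `y` of maximal norm in the 0-levels of
`S n` and `A`, it gives `‖x n‖ ≥ d (S n) A - ‖y‖`, which tends to infinity. -/
theorem vanishesAtInfinity_naiveSimplicialDepth {Ω : Type*} [MeasurableSpace Ω] (P : Measure Ω)
    [IsProbabilityMeasure P] {X : Ω → FuzzySet p} (hX : IsFuzzyRandomVariable X)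
    (J : Set (FuzzySet p)) {d : FuzzySet p → FuzzySet p → ℝ}
    (hd : ∀ A B : FuzzySet p, ∀ a b : ℝ, 0 ≤ a → 0 ≤ b → (∀ α, ∀ v ∈ A.level α, ‖v‖ ≤ a) →
      (∀ α, ∀ v ∈ B.level α, ‖v‖ ≤ b) → d A B ≤ a + b) :
    VanishesAtInfinity (fun A => naiveSimplicialDepth P A X) J d := by
  intro A _ S hS
  obtain ⟨y, -, hy⟩ := A.exists_norm_max
  choose x hx hmax using fun n => (S n).exists_norm_max
  refine tendsto_naiveSimplicialDepth_zero P hX hx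
    (tendsto_atTop_mono (fun n => ?_) (tendsto_atTop_add_const_right _ (-‖y‖) hS))
  have := hd (S n) A _ _ (norm_nonneg _) (norm_nonneg _) (hmax n) hy
  linarith

end Metrics

end FuzzyDepth

theorem mainTheorem2 {Ω : Type*} [MeasurableSpace Ω] (P : MeasureTheory.Measure Ω)
    [MeasureTheory.IsProbabilityMeasure P] (p : ℕ) (J : Set (FuzzyDepth.FuzzySet p))
    (X : Ω → FuzzyDepth.FuzzySet p) (hX : FuzzyDepth.IsFuzzyRandomVariable X) :
    FuzzyDepth.AffineInvariant (FuzzyDepth.naiveSimplicialDepth P) J X ∧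
    FuzzyDepth.VanishesAlongRays (fun A => FuzzyDepth.naiveSimplicialDepth P A X) J ∧
    (∀ r : ENNReal, 1 ≤ r →
      FuzzyDepth.VanishesAtInfinity (fun A => FuzzyDepth.naiveSimplicialDepth P A X) J
        (FuzzyDepth.dMetric r)) ∧
    (∀ r : ℝ, 1 ≤ r →
      FuzzyDepth.VanishesAtInfinity (fun A => FuzzyDepth.naiveSimplicialDepth P A X) J
        (FuzzyDepth.rhoMetric r)) :=
  ⟨FuzzyDepth.affineInvariant_naiveSimplicialDepth P J X,
    FuzzyDepth.vanishesAlongRays_naiveSimplicialDepth P hX J,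
    fun _ hr => FuzzyDepth.vanishesAtInfinity_naiveSimplicialDepth P hX J
      fun _ _ _ _ ha hb hA hB => FuzzyDepth.dMetric_le hr ha hb hA hB,
    fun _ hr => FuzzyDepth.vanishesAtInfinity_naiveSimplicialDepth P hX J
      fun _ _ _ _ ha hb hA hB => FuzzyDepth.rhoMetric_le hr ha hb hA hB⟩
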